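/- Let $\mathcal M=(\mathcal S,\mathcal A,r,P,\rho)$ be a Markov decision process with finite state space $\mathcal S$, finite action space $\mathcal A$, rewards $r:\mathcal S\times\mathcal A\to[0,1]$, transition probabilities $P(\cdot\mid s,a)$ and initial law $\rho$, and let $(\pi_\theta)_{\theta\in\Theta}$ be a family of stationary randomized policies. For each $\theta$, trajectories are generated by $a_t\sim\pi_\theta(\cdot\mid s_t)$, $s_{t+1}\sim P(\cdot\mid s_t,a_t)$; write $\mathbb E_\theta$ for the expectation over such trajectories, and $\mathbb E^\theta_s$ when $s_0=s$. Assume that for every $\theta$ the induced chain on $\mathcal S$, with transition probabilities $P^{\pi_\theta}(s,s')=\sum_a P(s'\mid s,a)\pi_\theta(a\mid s)$, has a single recurrent class $\mathcal S_R^\theta$ (transient states and periodicity are allowed). Put $$d^{\pi_\theta}(s)=\lim_{T\to\infty}\frac1T\sum_{t=0}^{T-1}\Pr(s_t=s\mid s_0\sim\rho,\pi_\theta),\qquad J(\theta)=\lim_{T\to\infty}\frac1T\,\mathbb E_\theta\Big[\sum_{t=0}^{T-1}r(s_t,a_t)\,\Big|\,s_0\sim\rho\Big],$$ $$V^{\pi_\theta}(s)=\lim_{N\to\infty}\frac1N\sum_{T=1}^N\mathbb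 E_\theta\Big[\sum_{t=0}^{T}(r(s_t,a_t)-J(\theta))\,\Big|\,s_0=s\Big],$$ $$Q^{\pi_\theta}(s,a)=\lim_{N\to\infty}\frac1N\sum_{T=1}^N\mathbb E_\theta\Big[\sum_{t=0}^{T}(r(s_t,a_t)-J(\theta))\,\Big|\,s_0=s,a_0=a\Big],$$ and $A^{\pi_\theta}=Q^{\pi_\theta}-V^{\pi_\theta}$. With $T_\theta=\inf\{t\ge0:s_t\in\mathcal S_R^\theta\}$ and $T_{s'}=\inf\{t\ge0:s_t=s'\}$, let $$C_{\mathrm{hit}}=\sup_{\theta}\max_{s\in\mathcal S}\mathbb E^\theta_s[T_\theta],\qquad C_{\mathrm{tar}}=\sup_\theta\sum_{s'\in\mathcal S}d^{\pi_\theta}(s')\,\mathbb E^\theta_{s_\theta}[T_{s'}],$$ where $s_\theta$ is any fixed state of $\mathcal S_R^\theta$; both suprema are taken in $[0,\infty]$, with $0\cdot\infty=0$. Then, for every $\theta\in\Theta$, all the limits above exist; $(V^{\pi_\theta},Q^{\pi_\theta})$ is the unique pair satisfying $Q(s,a)=r(s,a)-J(\theta)+\sum_{s'}P(s'\mid s,a)V(s')$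 and $V(s)=\sum_a\pi_\theta(a\mid s)Q(s,a)$ for all $(s,a)$, together with the normalization $\sum_s d^{\pi_\theta}(s)V(s)=0$; and for all $(s,a)\in\mathcal S\times\mathcal A$: (i) $V^{\pi_\theta}(s)\le 2(C_{\mathrm{hit}}+C_{\mathrm{tar}})$; (ii) $Q^{\pi_\theta}(s,a)\le 1+2(C_{\mathrm{hit}}+C_{\mathrm{tar}})$; (iii) $A^{\pi_\theta}(s,a)\le 1+4(C_{\mathrm{hit}}+C_{\mathrm{tar}})$. -/

import Mathlib

open MeasureTheory ProbabilityTheory Filter Topology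
open scoped ENNReal

/-- A finite Markov decision process `(S, A, r, P, ρ)` with rewards in `[0, 1]`
(finiteness of `S` and `A` is imposed by instance arguments below). -/
structure FinMDP (S A : Type*) where
  /-- reward function -/
  r : S → A → ℝ
  r_mem : ∀ s a, r s a ∈ Set.Icc (0 : ℝ) 1
  /-- transition function: `P s a` is the law of the next state -/
  P : S → A → PMF S
  /-- law of the initial state -/
  ρ : PMF S

namespace FinMDP

noncomputable section

variable {S A : Type*}

/-! ### Trajectories -/

/-- The law of `(s, a)` when `s ∼ μ` and `a ∼ π(· | s)`. -/
def withAction (π : S → PMF A) (μ : PMF S) : PMF (S × A) :=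
  μ.bind fun s => (π s).map fun a => (s, a)

/-- One step of the state-action chain: from `z = (s, a)` the next state is drawn from
`P(· | s, a)` and the next action from `π` at that state. -/
def step (M : FinMDP S A) (π : S → PMF A) (z : S × A) : PMF (S × A) :=
  withAction π (M.P z.1 z.2)

variable [Fintype S] [Fintype A] [MeasurableSpace S] [MeasurableSingletonClass S]
  [MeasurableSpace A] [MeasurableSingletonClass A]

/-- The transition kernel at time `n`: it looks only at the state-action pair at time `n`. -/
def stepKernel (M : FinMDP S A) (π : S → PMF A) (n : ℕ) :
    Kernel ((_ : Finset.Iic n) → S × A) (S × A) :=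
  (Kernel.ofFunOfCountable fun z : S × A => (M.step π z).toMeasure).comap
    (fun h => h ⟨n, Finset.mem_Iic.2 le_rfl⟩) (measurable_pi_apply _)

instance (M : FinMDP S A) (π : S → PMF A) (n : ℕ) : IsMarkovKernel (M.stepKernel π n) := by
  have : IsMarkovKernel
      (Kernel.ofFunOfCountable fun z : S × A => (M.step π z).toMeasure) :=
    ⟨fun z => PMF.toMeasure.isProbabilityMeasure (M.step π z)⟩
  unfold stepKernel
  infer_instance

/-- The law on `(S × A)^ℕ` of the trajectory `(s_t, a_t)_{t ≥ 0}` generated by the policy `π`,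
when `(s_0, a_0)` has law `init`. -/
def pathLaw (M : FinMDP S A) (π : S → PMF A) (init : PMF (S × A)) : Measure (ℕ → S × A) :=
  Kernel.trajMeasure (X := fun _ => S × A) init.toMeasure (M.stepKernel π)

/-- Trajectories with `s_0 ∼ ρ`. -/
def lawρ (M : FinMDP S A) (π : S → PMF A) : Measure (ℕ → S × A) :=
  M.pathLaw π (withAction π M.ρ)

/-- Trajectories with `s_0 = s`. -/
def lawFrom (M : FinMDP S A) (π : S → PMF A) (s : S) : Measure (ℕ → S × A) :=
  M.pathLaw π (withAction π (PMF.pure s))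

/-- Trajectories with `s_0 = s` and `a_0 = a`. -/
def lawFromAction (M : FinMDP S A) (π : S → PMF A) (s : S) (a : A) : Measure (ℕ → S × A) :=
  M.pathLaw π (PMF.pure (s, a))

/-! ### The induced chain on states: recurrence -/

/-- The induced transition probabilities `P^π(s, s') = ∑ a, P(s' | s, a) π(a | s)`. -/
def trans (M : FinMDP S A) (π : S → PMF A) (s s' : S) : ℝ :=
  ∑ a, (M.P s a s').toReal * (π s a).toReal

/-- `s'` is accessible from `s` in the induced chain (in zero or more steps). -/
def Accessible (M : FinMDP S A) (π : S → PMF A) : S → S → Prop :=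
  Relation.ReflTransGen fun s s' => 0 < M.trans π s s'

/-- A state of the (finite) induced chain is recurrent if it is accessible from every state
that is accessible from it. -/
def IsRecurrent (M : FinMDP S A) (π : S → PMF A) (s : S) : Prop :=
  ∀ s', M.Accessible π s s' → M.Accessible π s' s

/-- A recurrent class: the communicating class of a recurrent state. -/
def IsRecurrentClass (M : FinMDP S A) (π : S → PMF A) (C : Set S) : Prop :=
  ∃ s, M.IsRecurrent π s ∧ C = {s' | M.Accessible π s s' ∧ M.Accessible π s' s}

/-- The induced chain has a single recurrent class. -/
def IsUnichain (M : FinMDP S A) (π : S → PMF A) : Prop :=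
  ∃! C : Set S, M.IsRecurrentClass π C

/-- The set of recurrent states; for a unichain policy this is the recurrent class. -/
def recurrentStates (M : FinMDP S A) (π : S → PMF A) : Set S :=
  {s | M.IsRecurrent π s}

/-! ### Stationary distribution, average reward, value functions

The limits below are taken with `limUnder`; that they exist is part of the theorem. -/

/-- `(1 / T) ∑_{t < T} Pr(s_t = s | s_0 ∼ ρ)`. -/
def occupation (M : FinMDP S A) (π : S → PMF A) (s : S) (T : ℕ) : ℝ :=
  1 / (T : ℝ) * ∑ t ∈ Finset.range T, (M.lawρ π).real {ω | (ω t).1 = s}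

/-- The stationary distribution `d^π`. -/
def d (M : FinMDP S A) (π : S → PMF A) (s : S) : ℝ :=
  limUnder atTop (M.occupation π s)

/-- `(1 / T) E[∑_{t < T} r(s_t, a_t) | s_0 ∼ ρ]`. -/
def meanReward (M : FinMDP S A) (π : S → PMF A) (T : ℕ) : ℝ :=
  1 / (T : ℝ) * ∫ ω, ∑ t ∈ Finset.range T, M.r (ω t).1 (ω t).2 ∂(M.lawρ π)

/-- The long-term average reward `J^π`. -/
def J (M : FinMDP S A) (π : S → PMF A) : ℝ :=
  limUnder atTop (M.meanReward π)

/-- `(1 / N) ∑_{T=1}^N E[∑_{t=0}^T (r(s_t, a_t) - J^π)]` for trajectories with law `μ`. -/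
def cesaro (M : FinMDP S A) (π : S → PMF A) (μ : Measure (ℕ → S × A)) (N : ℕ) : ℝ :=
  1 / (N : ℝ) * ∑ T ∈ Finset.Icc 1 N,
    ∫ ω, ∑ t ∈ Finset.range (T + 1), (M.r (ω t).1 (ω t).2 - M.J π) ∂μ

/-- The state value function `V^π`, as a Cesàro limit. -/
def V (M : FinMDP S A) (π : S → PMF A) (s : S) : ℝ :=
  limUnder atTop (M.cesaro π (M.lawFrom π s))

/-- The state-action value function `Q^π`, as a Cesàro limit. -/
def Q (M : FinMDP S A) (π : S → PMF A) (s : S) (a : A) : ℝ :=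
  limUnder atTop (M.cesaro π (M.lawFromAction π s a))

/-- The advantage function `A^π = Q^π - V^π`. -/
def adv (M : FinMDP S A) (π : S → PMF A) (s : S) (a : A) : ℝ :=
  M.Q π s a - M.V π s

/-- `q` solves the average-reward Bellman equation of `π`, with associated state values
`v(s) = ∑ a, π(a | s) q(s, a)` normalized to have mean zero under `d^π`. -/
def IsNormalizedBellman (M : FinMDP S A) (π : S → PMF A) (v : S → ℝ) (q : S → A → ℝ) : Prop :=
  (∀ s a, q s a = M.r s a - M.J π + ∑ s', (M.P s a s').toReal * v s') ∧
  (∀ s, v s = ∑ a, (π s a).toReal * q s a) ∧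
  ∑ s, M.d π s * v s = 0

/-! ### Hitting times and the constants -/

/-- The first time `t ≥ 0` at which the state lies in `B` (`∞` if there is none). -/
def hitTime (B : Set S) (ω : ℕ → S × A) : ℝ≥0∞ :=
  ⨅ t ∈ {t : ℕ | (ω t).1 ∈ B}, (t : ℝ≥0∞)

/-- The expected value of `hitTime B` from the state `s`. -/
def expHit (M : FinMDP S A) (π : S → PMF A) (s : S) (B : Set S) : ℝ≥0∞ :=
  ∫⁻ ω, hitTime B ω ∂(M.lawFrom π s)

/-- `max_s E_s[T]`, with `T` the entrance time of the recurrent class. -/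
def CHitOf (M : FinMDP S A) (π : S → PMF A) : ℝ≥0∞ :=
  ⨆ s, M.expHit π s (M.recurrentStates π)

/-- `∑_{s'} d^π(s') E_s[T_{s'}]`, the expected time to reach a target drawn from `d^π`
from the state `s` (terms with `d^π(s') = 0` vanish). -/
def CTarOf (M : FinMDP S A) (π : S → PMF A) (s : S) : ℝ≥0∞ :=
  ∑ s', ENNReal.ofReal (M.d π s') * M.expHit π s {s'}

variable {Θ : Type*}

/-- `C_hit = sup_θ C_hit^θ`. -/
def CHit (M : FinMDP S A) (π : Θ → S → PMF A) : ℝ≥0∞ :=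
  ⨆ θ, M.CHitOf (π θ)

/-- `C_tar = sup_θ C_tar^θ`, where `C_tar^θ` is computed from the starting state `base θ`. -/
def CTar (M : FinMDP S A) (π : Θ → S → PMF A) (base : Θ → S) : ℝ≥0∞ :=
  ⨆ θ, M.CTarOf (π θ) (base θ)

end

end FinMDP

/-! The bounds come from the random target lemma. For a recurrent target `y` let `g y` be the finite
solution of the first-step equations for the expected time to reach `y`, and put `h s = ∑ y, d y * g
y s`. Off `y` one has `g y = 1 + P (g y)`. At `y` the equation fails by the mean return time, whose
product with `d y` is 1 by Kac's formula. Hence `h = 1 + P h - 1_R`, where `R` is the recurrent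
class. So `h` is harmonic on `R`, thus constant there, and `h ≤ h b + k` everywhere, with `b ∈ R`
and `k` the expected entrance time of `R`.

The reward minus its mean lies in `[-1, 1]`, so both `V` and `-V` satisfy `w ≤ 1 + P w`. The maximum
principle gives `w s - w y ≤ g y s`. Averaging over `y` with weights `d y`, and using that `w` has
mean zero, gives `|V| ≤ h ≤ k + h b`. Therefore `|V| ≤ C`, where `C` is `C_hit + C_tar`. The Bellman
equation then gives `Q ≤ 1 + C` and `A ≤ 1 + 2 C`, which is stronger than the stated bounds.

The existence of the limits rests on the Poisson equation `f = c + v - P v`, solvable for some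
constant `c` because a recurrent state of a unichain policy is accessible from everywhere. Along a
trajectory such an `f` telescopes in expectation, so its averages tend to `c` under every initial
law, periodic or not.

The analytic estimates (`nonpos_of_subharmonic`, `ofReal_abs_le`) concern a stochastic matrix only.
The link with trajectories is `expHit_first_step` for hitting times and `tendsto_average_integral`
for averages. -/

namespace StochMatrix

/-! ### Potential theory of a finite stochastic matrix -/

variable {S : Type*} [Fintype S] {p : S → S → ℝ}

/-- Maximum principle: a function which is subharmonic on `F \ B` and nonpositive on `F ∩ B` is
nonpositive on `F`, if `F` can be left only through `B` and `B` is accessible from `F`. -/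
theorem nonpos_of_subharmonic (hp0 : ∀ s s', 0 ≤ p s s') (hp1 : ∀ s, ∑ s', p s s' = 1)
    {F B : Set S} (hF : ∀ s ∈ F, s ∉ B → ∀ s', 0 < p s s' → s' ∈ F)
    (hreach : ∀ s ∈ F, ∃ y ∈ B, Relation.ReflTransGen (fun a b => 0 < p a b) s y)
    {w : S → ℝ} (hw : ∀ s ∈ F, s ∉ B → w s ≤ ∑ s', p s s' * w s')
    (hB : ∀ s ∈ F, s ∈ B → w s ≤ 0) : ∀ s ∈ F, w s ≤ 0 := by
  by_contra! hcon
  obtain ⟨s₀, hs₀, hpos⟩ := hcon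
  obtain ⟨m, hm, hmax⟩ := Set.exists_max_image F w (Set.toFinite F) ⟨s₀, hs₀⟩
  have hmpos : 0 < w m := hpos.trans_le (hmax _ hs₀)
  -- A positive maximum propagates along transitions: `w m` is at most a convex combination of
  -- values that do not exceed it. The path never meets `B` before its endpoint, since `w ≤ 0`
  -- there.
  have key : ∀ x, Relation.ReflTransGen (fun a b => 0 < p a b) m x → x ∈ F ∧ w x = w m := by
    intro x hx
    induction hx with
    | refl => exact ⟨hm, rfl⟩
    | @tail x x' _ hxx' ih =>
      obtain ⟨hxF, hxw⟩ := ih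
      have hxB : x ∉ B := fun h => by linarith [hB x hxF h]
      have hx'F := hF x hxF hxB x' hxx'
      refine ⟨hx'F, ?_⟩
      have hnn : ∀ s' ∈ Finset.univ, 0 ≤ p x s' * (w m - w s') := by
        intro s' _
        rcases (hp0 x s').eq_or_lt with h | h
        · simp [← h]
        · exact mul_nonneg h.le (sub_nonneg.2 (hmax _ (hF x hxF hxB s' h)))
      have hsum : ∑ s', p x s' * (w m - w s') = w m - ∑ s', p x s' * w s' := by
        simp only [mul_sub, Finset.sum_sub_distrib, ← Finset.sum_mul, hp1, one_mul]
      have hle := Finset.single_le_sum hnn (Finset.mem_univ x')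
      have h1 := hw x hxF hxB
      have h2 : p x x' * (w m - w x') = 0 :=
        le_antisymm (by linarith) (hnn x' (Finset.mem_univ _))
      rcases mul_eq_zero.1 h2 with h | h <;> linarith
  obtain ⟨y, hy, hmy⟩ := hreach m hm
  obtain ⟨hyF, hyw⟩ := key y hmy
  linarith [hB y hyF hy]

/-- A function that is harmonic on a closed set is constant there, if some point of the set is
accessible from all the others. -/
theorem eq_of_harmonicOn (hp0 : ∀ s s', 0 ≤ p s s') (hp1 : ∀ s, ∑ s', p s s' = 1)
    {F : Set S} (hF : ∀ s ∈ F, ∀ s', 0 < p s s' → s' ∈ F) {y : S}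
    (hreach : ∀ s ∈ F, Relation.ReflTransGen (fun a b => 0 < p a b) s y)
    {f : S → ℝ} (hf : ∀ s ∈ F, f s = ∑ s', p s s' * f s') : ∀ s ∈ F, f s = f y := by
  have h1 := nonpos_of_subharmonic hp0 hp1 (F := F) (B := {y}) (fun s hs _ => hF s hs)
    (fun s hs => ⟨y, rfl, hreach s hs⟩) (w := fun s => f s - f y)
    (fun s hs _ => by
      simp only [mul_sub, Finset.sum_sub_distrib, ← Finset.sum_mul, hp1, one_mul, ← hf s hs]
      rfl) (fun s _ h => by simp [Set.mem_singleton_iff.1 h])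
  have h2 := nonpos_of_subharmonic hp0 hp1 (F := F) (B := {y}) (fun s hs _ => hF s hs)
    (fun s hs => ⟨y, rfl, hreach s hs⟩) (w := fun s => f y - f s)
    (fun s hs _ => by
      simp only [mul_sub, Finset.sum_sub_distrib, ← Finset.sum_mul, hp1, one_mul, ← hf s hs]
      rfl) (fun s _ h => by simp [Set.mem_singleton_iff.1 h])
  intro s hs
  linarith [h1 s hs, h2 s hs]

/-- The averaging operator `f ↦ ∑ s', p(·, s') f(s')`. -/
noncomputable def avg (p : S → S → ℝ) : (S → ℝ) →ₗ[ℝ] (S → ℝ) where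
  toFun f s := ∑ s', p s s' * f s'
  map_add' f g := by ext s; simp [mul_add, Finset.sum_add_distrib]
  map_smul' c f := by ext s; simp [Finset.mul_sum, mul_left_comm]

/-- The first-step equations for the expected time to reach `B` have a solution. -/
theorem exists_hitting_solution (hp0 : ∀ s s', 0 ≤ p s s') (hp1 : ∀ s, ∑ s', p s s' = 1)
    {B : Set S} (hreach : ∀ s, ∃ y ∈ B, Relation.ReflTransGen (fun a b => 0 < p a b) s y) :
    ∃ g : S → ℝ, (∀ s ∈ B, g s = 0) ∧ ∀ s ∉ B, g s = 1 + ∑ s', p s s' * g s' := by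
  classical
  -- `D` is the averaging operator with its values on `B` set to zero. `id - D` is injective by the
  -- maximum principle, hence surjective in finite dimension.
  let D : (S → ℝ) →ₗ[ℝ] (S → ℝ) := LinearMap.pi fun s =>
    if s ∈ B then 0 else LinearMap.proj s ∘ₗ avg p
  let L := LinearMap.id - D
  have hL : ∀ f s, L f s = f s - if s ∈ B then 0 else ∑ s', p s s' * f s' := by
    intro f s
    by_cases h : s ∈ B <;> simp [L, D, h, avg]
  have hinj : Function.Injective L := by
    rw [← LinearMap.ker_eq_bot, LinearMap.ker_eq_bot']
    intro f hf
    have hfs : ∀ s, f s = if s ∈ B then 0 else ∑ s', p s s' * f s' := fun s => by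
      have := congrFun hf s
      rw [hL] at this
      exact sub_eq_zero.1 this
    have h1 := nonpos_of_subharmonic hp0 hp1 (F := Set.univ) (B := B) (fun _ _ _ _ _ => trivial)
      (fun s _ => hreach s) (w := f) (fun s _ hs => by simpa [hs] using (hfs s).le)
      (fun s _ hs => by simpa [hs] using (hfs s).le)
    have h2 := nonpos_of_subharmonic hp0 hp1 (F := Set.univ) (B := B) (fun _ _ _ _ _ => trivial)
      (fun s _ => hreach s) (w := -f) (fun s _ hs => by simpa [hs] using (hfs s).ge)
      (fun s _ hs => by simpa [hs] using (hfs s).ge)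
    ext s
    exact le_antisymm (h1 s trivial) (by simpa using h2 s trivial)
  obtain ⟨g, hg⟩ := LinearMap.injective_iff_surjective.1 hinj fun s => if s ∈ B then 0 else 1
  refine ⟨g, fun s hs => ?_, fun s hs => ?_⟩
  · simpa [hL, hs] using congrFun hg s
  · have := congrFun hg s
    simp only [hL, hs, if_false] at this
    linarith

/-- The Poisson equation can be solved, for a suitable constant, if some state is accessible from
every state. -/
theorem exists_poisson_solution (hp0 : ∀ s s', 0 ≤ p s s') (hp1 : ∀ s, ∑ s', p s s' = 1)
    {y : S} (hreach : ∀ s, Relation.ReflTransGen (fun a b => 0 < p a b) s y) (f : S → ℝ) :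
    ∃ (c : ℝ) (v : S → ℝ), ∀ s, f s = c + v s - ∑ s', p s s' * v s' := by
  -- `id - avg p` kills the constants; adding evaluation at `y` restores injectivity, and the value
  -- `v y` becomes the constant of the Poisson equation.
  let E : (S → ℝ) →ₗ[ℝ] (S → ℝ) := LinearMap.pi fun _ => LinearMap.proj y
  let L := LinearMap.id - avg p + E
  have hL : ∀ f s, L f s = f s - ∑ s', p s s' * f s' + f y := fun f s => by simp [L, E, avg]
  have hinj : Function.Injective L := by
    rw [← LinearMap.ker_eq_bot, LinearMap.ker_eq_bot']
    intro f hf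
    have hfs : ∀ s, f s - ∑ s', p s s' * f s' + f y = 0 := fun s => by
      rw [← hL]; exact congrFun hf s
    have : Nonempty S := ⟨y⟩
    obtain ⟨a, ha⟩ := Finite.exists_max f
    obtain ⟨b, hb⟩ := Finite.exists_min f
    have h1 : ∑ s', p a s' * f s' ≤ f a := by
      calc _ ≤ ∑ s', p a s' * f a :=
            Finset.sum_le_sum fun s' _ => mul_le_mul_of_nonneg_left (ha s') (hp0 _ _)
        _ = f a := by rw [← Finset.sum_mul, hp1, one_mul]
    have h2 : f b ≤ ∑ s', p b s' * f s' := by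
      calc f b = ∑ s', p b s' * f b := by rw [← Finset.sum_mul, hp1, one_mul]
        _ ≤ _ := Finset.sum_le_sum fun s' _ => mul_le_mul_of_nonneg_left (hb s') (hp0 _ _)
    -- The equation at a maximum point of `f` gives `f y ≤ 0`, and at a minimum point `f y ≥ 0`.
    have hy : f y = 0 := by linarith [hfs a, hfs b]
    have := eq_of_harmonicOn hp0 hp1 (F := Set.univ) (fun _ _ _ _ => trivial)
      (fun s _ => hreach s) (f := f) (fun s _ => by linarith [hfs s])
    ext s
    rw [this s trivial, hy]
    rfl
  obtain ⟨v, hv⟩ := LinearMap.injective_iff_surjective.1 hinj f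
  refine ⟨v y, v, fun s => ?_⟩
  rw [← hv, hL]
  ring

/-- The solution of the first-step equations is dominated by every supersolution with values in
`[0, ∞]`. -/
theorem hitting_solution_le (hp0 : ∀ s s', 0 ≤ p s s') (hp1 : ∀ s, ∑ s', p s s' = 1)
    {B : Set S} (hreach : ∀ s, ∃ y ∈ B, Relation.ReflTransGen (fun a b => 0 < p a b) s y)
    {g : S → ℝ} (hgB : ∀ s ∈ B, g s = 0) (hg : ∀ s ∉ B, g s = 1 + ∑ s', p s s' * g s')
    {u : S → ℝ≥0∞} (hu : ∀ s ∉ B, 1 + ∑ s', ENNReal.ofReal (p s s') * u s' ≤ u s) (s : S) :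
    ENNReal.ofReal (g s) ≤ u s := by
  by_cases hs : u s = ⊤
  · simp [hs]
  have hterm : ∀ s, u s ≠ ⊤ → s ∉ B → ∀ s', ENNReal.ofReal (p s s') * u s' ≠ ⊤ := by
    intro s hs hsB s' h
    apply hs
    rw [eq_top_iff]
    refine le_trans ?_ (hu s hsB)
    refine le_add_left ?_
    rw [← h]
    exact Finset.single_le_sum (f := fun s' => ENNReal.ofReal (p s s') * u s')
      (fun _ _ => zero_le) (Finset.mem_univ s')
  -- The maximum principle is applied on the set where `u` is finite. Off `B` that set is closed
  -- under transitions, since an infinite value at a successor would make `u s` infinite.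
  have h := nonpos_of_subharmonic hp0 hp1 (F := {s | u s ≠ ⊤}) (B := B)
    (fun s hs hsB s' hss' h => hterm s hs hsB s' (by
      rw [h, ENNReal.mul_top (by simpa using hss')]))
    (fun s _ => hreach s) (w := fun s => g s - (u s).toReal)
    (fun s hs hsB => by
      have h1 := ENNReal.toReal_mono hs (hu s hsB)
      rw [ENNReal.toReal_add (by simp) (ENNReal.sum_ne_top.2 fun s' _ => hterm s hs hsB s'),
        ENNReal.toReal_sum fun s' _ => hterm s hs hsB s'] at h1
      simp only [ENNReal.toReal_mul, ENNReal.toReal_ofReal (hp0 _ _), ENNReal.toReal_one] at h1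
      simp only [mul_sub, Finset.sum_sub_distrib]
      linarith [hg s hsB])
    (fun s _ hsB => by simp [hgB s hsB])
    s hs
  rw [← ENNReal.ofReal_toReal hs]
  exact ENNReal.ofReal_le_ofReal (by linarith)

/-- If the stationary mean of the solution `g` of `g = 1 + P g` off `y`, `g(y) = 0`, is taken, one
gets Kac's formula. -/
theorem kac_formula {d : S → ℝ}
    (hd : ∀ (f : S → ℝ) (c : ℝ) (v : S → ℝ),
      (∀ s, f s = c + v s - ∑ s', p s s' * v s') → ∑ s, d s * f s = c)
    {y : S} {g : S → ℝ} (hgy : g y = 0) (hg : ∀ s ≠ y, g s = 1 + ∑ s', p s s' * g s') :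
    d y * (1 + ∑ s', p y s' * g s') = 1 := by
  classical
  -- `-g` solves a Poisson equation with constant 1 whose right-hand side is supported at `y`.
  have h := hd (fun s => if s = y then 1 + ∑ s', p y s' * g s' else 0) 1 (fun s => - g s) fun s => by
    by_cases hs : s = y
    · subst hs; simp [hgy]
    · simp [hs, hg s hs]
  simpa using h

/-- A solution of a normalized Poisson equation whose right-hand side lies in `[-1, 1]` is bounded
by the maximal expected entrance time of the recurrent class plus the expected time to reach a
random target, for any supersolution `u` of the first-step equations. -/
theorem ofReal_abs_le (hp0 : ∀ s s', 0 ≤ p s s') (hp1 : ∀ s, ∑ s', p s s' = 1)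
    {R : Set S} (hR : ∀ s ∈ R, ∀ s', 0 < p s s' → s' ∈ R)
    (hreach : ∀ s, ∀ y ∈ R, Relation.ReflTransGen (fun a b => 0 < p a b) s y)
    {d : S → ℝ} (hd0 : ∀ s, 0 ≤ d s)
    (hd : ∀ (f : S → ℝ) (c : ℝ) (v : S → ℝ),
      (∀ s, f s = c + v s - ∑ s', p s s' * v s') → ∑ s, d s * f s = c)
    {b : S} (hb : b ∈ R) {e v : S → ℝ} (he : ∀ s, |e s| ≤ 1)
    (hv : ∀ s, v s = e s + ∑ s', p s s' * v s') (hdv : ∑ s, d s * v s = 0)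
    {u : S → Set S → ℝ≥0∞}
    (hu : ∀ B, ∀ s ∉ B, 1 + ∑ s', ENNReal.ofReal (p s s') * u s' B ≤ u s B) (s : S) :
    ENNReal.ofReal |v s| ≤ (⨆ s, u s R) + ∑ y, ENNReal.ofReal (d y) * u b {y} := by
  classical
  have hd1 : ∑ s, d s = 1 := by
    simpa using hd (fun _ => 1) 1 0 (fun s => by simp)
  have hreachR : ∀ s, ∃ y ∈ R, Relation.ReflTransGen (fun a b => 0 < p a b) s y :=
    fun s => ⟨b, hb, hreach s b hb⟩
  obtain ⟨k, hkR, hk⟩ := exists_hitting_solution hp0 hp1 hreachR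
  have hPkR : ∀ s ∈ R, ∑ s', p s s' * k s' = 0 := fun s hs => Finset.sum_eq_zero fun s' _ => by
    rcases (hp0 s s').eq_or_lt with h | h
    · simp [← h]
    · simp [hkR s' (hR s hs s' h)]
  have hdR : ∀ s ∉ R, d s = 0 := by
    -- The indicator of the complement of `R` equals `k - P k`, so its mean under `d` is zero.
    have h := hd (fun s => if s ∈ R then 0 else 1) 0 k fun s => by
      by_cases hs : s ∈ R
      · simp [hs, hkR s hs, hPkR s hs]
      · rw [if_neg hs, hk s hs]; ring
    rw [Finset.sum_eq_zero_iff_of_nonneg fun s _ => mul_nonneg (hd0 s) (by split_ifs <;> simp)] at h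
    intro s hs
    simpa [hs] using h s (Finset.mem_univ s)
  -- For `y ∉ R` the choice of `g y` is irrelevant, because `d y = 0`.
  have hex : ∀ y, ∃ g : S → ℝ, y ∈ R → g y = 0 ∧ ∀ s ≠ y, g s = 1 + ∑ s', p s s' * g s' := by
    intro y
    by_cases hy : y ∈ R
    · obtain ⟨g, h1, h2⟩ := exists_hitting_solution hp0 hp1 (B := {y})
        fun s => ⟨y, rfl, hreach s y hy⟩
      exact ⟨g, fun _ => ⟨h1 y rfl, fun s hs => h2 s hs⟩⟩
    · exact ⟨0, fun h => absurd h hy⟩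
  choose g hg using hex
  -- the expected time to reach a random target
  let h : S → ℝ := fun s => ∑ y, d y * g y s
  have hPh : ∀ s, ∑ s', p s s' * h s' = ∑ y, d y * ∑ s', p s s' * g y s' := by
    intro s
    simp only [h, Finset.mul_sum]
    rw [Finset.sum_comm]
    exact Finset.sum_congr rfl fun _ _ => Finset.sum_congr rfl fun _ _ => by ring
  have hcorr : ∀ s, h s = 1 + ∑ s', p s s' * h s' - if s ∈ R then 1 else 0 := by
    intro s
    -- The correction term appears only at `s = y`, where Kac's formula makes it exactly 1.
    have hterm : ∀ y, d y * g y s = d y * (1 + ∑ s', p s s' * g y s')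
        - if s = y ∧ y ∈ R then 1 else 0 := by
      intro y
      by_cases hy : y ∈ R
      · obtain ⟨h1, h2⟩ := hg y hy
        by_cases hs : s = y
        · subst hs
          rw [kac_formula hd h1 h2]
          simp [hy, h1]
        · rw [← h2 s hs]; simp [hs]
      · simp [hdR y hy, hy]
    have : h s = ∑ y, (d y * (1 + ∑ s', p s s' * g y s') - if s = y ∧ y ∈ R then 1 else 0) :=
      Finset.sum_congr rfl fun y _ => hterm y
    rw [this, hPh, Finset.sum_sub_distrib]
    simp only [mul_add, mul_one, Finset.sum_add_distrib, hd1]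
    congr 1
    by_cases hs : s ∈ R
    · rw [if_pos hs, Finset.sum_eq_single s (fun y _ hy => by simp [hy.symm]) (by simp)]
      simp [hs]
    · rw [if_neg hs]
      exact Finset.sum_eq_zero fun y _ => if_neg fun hy : s = y ∧ y ∈ R => hs (hy.1 ▸ hy.2)
  have hRconst : ∀ s ∈ R, h s = h b :=
    eq_of_harmonicOn hp0 hp1 hR (fun s _ => hreach s b hb) fun s hs => by
      have := hcorr s
      simp only [hs, if_true] at this
      linarith
  have hle : h s ≤ h b + k s := by
    have := nonpos_of_subharmonic hp0 hp1 (F := Set.univ) (B := R) (fun _ _ _ _ _ => trivial)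
      (fun s _ => hreachR s) (w := fun s => h s - h b - k s)
      (fun s _ hs => by
        have h1 := hcorr s
        have h2 := hk s hs
        simp only [hs, if_false] at h1
        simp only [mul_sub, Finset.sum_sub_distrib, ← Finset.sum_mul, hp1, one_mul]
        linarith)
      (fun s _ hs => by simp [hRconst s hs, hkR s hs]) s trivial
    linarith
  -- `w - w y - g y` is subharmonic off `y` and vanishes at `y`.
  have hdiff : ∀ y ∈ R, ∀ w : S → ℝ, (∀ s, w s ≤ 1 + ∑ s', p s s' * w s') →
      w s - w y ≤ g y s := by
    intro y hy w hw
    obtain ⟨h1, h2⟩ := hg y hy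
    have := nonpos_of_subharmonic hp0 hp1 (F := Set.univ) (B := {y}) (fun _ _ _ _ _ => trivial)
      (fun s _ => ⟨y, rfl, hreach s y hy⟩) (w := fun s => w s - w y - g y s)
      (fun s _ hs => by
        have h3 := h2 s hs
        have h4 := hw s
        simp only [mul_sub, Finset.sum_sub_distrib, ← Finset.sum_mul, hp1, one_mul]
        linarith)
      (fun s _ hs => by simp [Set.mem_singleton_iff.1 hs, h1]) s trivial
    linarith
  have hup : ∀ w : S → ℝ, (∀ s, w s ≤ 1 + ∑ s', p s s' * w s') → ∑ s, d s * w s = 0 →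
      w s ≤ h s := by
    intro w hw hdw
    calc w s = ∑ y, d y * (w s - w y) := by
          simp only [mul_sub, Finset.sum_sub_distrib, ← Finset.sum_mul, hd1, one_mul, hdw, sub_zero]
      _ ≤ h s := Finset.sum_le_sum fun y _ => by
          by_cases hy : y ∈ R
          · exact mul_le_mul_of_nonneg_left (hdiff y hy w hw) (hd0 y)
          · simp [hdR y hy]
  have habs : |v s| ≤ k s + h b := by
    refine (abs_le'.2 ⟨hup v (fun s => ?_) hdv, ?_⟩).trans (by linarith)
    · linarith [hv s, (abs_le.1 (he s)).2]
    · refine hup (-v) (fun s => ?_) (by simp [hdv])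
      simp only [Pi.neg_apply, mul_neg, Finset.sum_neg_distrib]
      linarith [hv s, (abs_le.1 (he s)).1]
  refine (ENNReal.ofReal_le_ofReal habs).trans (ENNReal.ofReal_add_le.trans (add_le_add ?_ ?_))
  · exact (hitting_solution_le hp0 hp1 hreachR hkR hk (hu R) s).trans (le_iSup (fun s => u s R) s)
  · refine (Finset.le_sum_of_subadditive ENNReal.ofReal ENNReal.ofReal_zero.le
      (fun _ _ => ENNReal.ofReal_add_le) _ _).trans (Finset.sum_le_sum fun y _ => ?_)
    by_cases hy : y ∈ R
    · rw [ENNReal.ofReal_mul (hd0 y)]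
      obtain ⟨h1, h2⟩ := hg y hy
      exact mul_le_mul_right (hitting_solution_le hp0 hp1 (B := {y})
        (fun s => ⟨y, rfl, hreach s y hy⟩) (fun s hs => by rw [Set.mem_singleton_iff.1 hs, h1])
        (fun s hs => h2 s hs) (hu {y}) b) _
    · simp [hdR y hy]

end StochMatrix

namespace FinMDP

/-! ### One-step laws and hitting times of the state-action chain -/

variable {S A : Type*}

theorem withAction_apply (π : S → PMF A) (μ : PMF S) (s : S) (a : A) :
    withAction π μ (s, a) = μ s * π s a := by
  classical
  rw [withAction, PMF.bind_apply, tsum_eq_single s]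
  · rw [PMF.map_apply, tsum_eq_single a]
    · simp
    · intro a' ha'; simp [ha'.symm]
  · intro s' hs'
    simp [PMF.map_apply, hs'.symm]

/-- Every step of the state-action chain consists of a transition and a choice of an action. -/
theorem step_apply (M : FinMDP S A) (π : S → PMF A) (z : S × A) (s : S) (a : A) :
    M.step π z (s, a) = M.P z.1 z.2 s * π s a :=
  withAction_apply π _ s a

theorem sum_eq_one {X : Type*} [Fintype X] (μ : PMF X) : ∑ x, μ x = 1 := by
  have h := μ.tsum_coe
  rwa [tsum_fintype] at h

theorem sum_toReal_eq_one {X : Type*} [Fintype X] (μ : PMF X) : ∑ x, (μ x).toReal = 1 := by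
  rw [← ENNReal.toReal_sum fun x _ => μ.apply_ne_top x, sum_eq_one, ENNReal.toReal_one]

/-! ### Hitting times -/

open Classical in
/-- The indicator function of the state-action pairs whose state is not in `B`. -/
noncomputable def outside (B : Set S) (z : S × A) : ℝ≥0∞ := if z.1 ∈ B then 0 else 1

/-- This is `T = ∑ n, 1{T > n}`, valid also when `T = ∞`. The factor at time `n` is split off to fit
the form treated in `lintegral_killed`. -/
theorem hitTime_eq_tsum (B : Set S) (ω : ℕ → S × A) :
    hitTime B ω = ∑' n, (∏ i ∈ Finset.range n, outside B (ω i)) * outside B (ω n) := by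
  classical
  simp only [← Finset.prod_range_succ]
  by_cases h : ∃ t, (ω t).1 ∈ B
  · have h1 : hitTime B ω = (Nat.find h : ℕ) :=
      le_antisymm (iInf₂_le (Nat.find h) (Nat.find_spec h))
        (le_iInf₂ fun t ht => Nat.cast_le.2 (Nat.find_min' h ht))
    have h2 : ∀ n, ∏ i ∈ Finset.range (n + 1), outside B (ω i) =
        if n < Nat.find h then 1 else 0 := by
      intro n
      split_ifs with hn
      · refine Finset.prod_eq_one fun i hi => if_neg (Nat.find_min h ?_)
        have := Finset.mem_range.1 hi
        omega
      · exact Finset.prod_eq_zero (Finset.mem_range.2 (by omega : Nat.find h < n + 1))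
          (if_pos (Nat.find_spec h))
    simp only [h1, h2]
    rw [tsum_eq_sum (s := Finset.range (Nat.find h)) fun n hn => if_neg (by simpa using hn),
      Finset.sum_congr rfl fun n hn => if_pos (Finset.mem_range.1 hn)]
    simp
  · push Not at h
    have h2 : ∀ n, ∏ i ∈ Finset.range (n + 1), outside B (ω i) = 1 := fun n =>
      Finset.prod_eq_one fun i _ => if_neg (h i)
    simp only [h2, ENNReal.tsum_const_eq_top_of_ne_zero one_ne_zero]
    simp [hitTime, h]

variable [Fintype A]

theorem trans_nonneg (M : FinMDP S A) (π : S → PMF A) (s s' : S) : 0 ≤ M.trans π s s' :=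
  Finset.sum_nonneg fun _ _ => by positivity


theorem ofReal_trans (M : FinMDP S A) (π : S → PMF A) (s s' : S) :
    ENNReal.ofReal (M.trans π s s') = ∑ a, M.P s a s' * π s a := by
  rw [trans, ENNReal.ofReal_sum_of_nonneg fun _ _ => by positivity]
  refine Finset.sum_congr rfl fun a _ => ?_
  rw [← ENNReal.toReal_mul, ENNReal.ofReal_toReal]
  exact ENNReal.mul_ne_top (PMF.apply_ne_top _ _) (PMF.apply_ne_top _ _)

variable [Fintype S]

theorem sum_trans (M : FinMDP S A) (π : S → PMF A) (s : S) : ∑ s', M.trans π s s' = 1 := by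
  simp only [trans]
  rw [Finset.sum_comm]
  simp only [← Finset.sum_mul, sum_toReal_eq_one, one_mul]


/-- The conditional expectation of `φ(s_{t+1}, a_{t+1})` given `(s_t, a_t) = z`. -/
noncomputable def next (M : FinMDP S A) (π : S → PMF A) (φ : S × A → ℝ) (z : S × A) : ℝ :=
  ∑ s, (M.P z.1 z.2 s).toReal * ∑ a, (π s a).toReal * φ (s, a)

/-- The conditional expectation of `φ(s_{t+1}, a_{t+1})` given `(s_t, a_t) = z`, for functions
with values in `[0, ∞]`. -/
noncomputable def enext (M : FinMDP S A) (π : S → PMF A) (φ : S × A → ℝ≥0∞) (z : S × A) : ℝ≥0∞ :=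
  ∑ s, M.P z.1 z.2 s * ∑ a, π s a * φ (s, a)

/-! ### Markov property of the trajectory law and first-step equations -/

variable [MeasurableSpace S] [MeasurableSingletonClass S]
  [MeasurableSpace A] [MeasurableSingletonClass A]

instance (M : FinMDP S A) (π : S → PMF A) (init : PMF (S × A)) :
    IsProbabilityMeasure (M.pathLaw π init) := by
  unfold pathLaw
  infer_instance

theorem lintegral_toMeasure {X : Type*} [Fintype X] [MeasurableSpace X]
    [MeasurableSingletonClass X] (μ : PMF X) (φ : X → ℝ≥0∞) :
    ∫⁻ x, φ x ∂μ.toMeasure = ∑ x, μ x * φ x := by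
  rw [lintegral_fintype]
  exact Finset.sum_congr rfl fun x _ => by
    rw [PMF.toMeasure_apply_singleton _ _ (measurableSet_singleton x), mul_comm]

theorem stepKernel_apply (M : FinMDP S A) (π : S → PMF A) (n : ℕ)
    (h : (_ : Finset.Iic n) → S × A) :
    M.stepKernel π n h = (M.step π (h ⟨n, Finset.mem_Iic.2 le_rfl⟩)).toMeasure := rfl

theorem lintegral_stepKernel (M : FinMDP S A) (π : S → PMF A) (n : ℕ)
    (h : (_ : Finset.Iic n) → S × A) (φ : S × A → ℝ≥0∞) :
    ∫⁻ z, φ z ∂(M.stepKernel π n h) = M.enext π φ (h ⟨n, Finset.mem_Iic.2 le_rfl⟩) := by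
  rw [stepKernel_apply, lintegral_toMeasure, Fintype.sum_prod_type]
  simp only [step_apply, enext, Finset.mul_sum, mul_assoc]

theorem integral_stepKernel (M : FinMDP S A) (π : S → PMF A) (n : ℕ)
    (h : (_ : Finset.Iic n) → S × A) (φ : S × A → ℝ) :
    ∫ z, φ z ∂(M.stepKernel π n h) = M.next π φ (h ⟨n, Finset.mem_Iic.2 le_rfl⟩) := by
  rw [stepKernel_apply, PMF.integral_eq_sum, Fintype.sum_prod_type]
  simp only [step_apply, next, Finset.mul_sum, ENNReal.toReal_mul, smul_eq_mul, mul_assoc]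

theorem map_pathLaw_zero (M : FinMDP S A) (π : S → PMF A) (init : PMF (S × A)) :
    (M.pathLaw π init).map (fun ω => ω 0) = init.toMeasure := by
  have h : (fun ω : ℕ → S × A => ω 0) =
      (MeasurableEquiv.piUnique (fun _ : Finset.Iic 0 => S × A)) ∘ Preorder.frestrictLe 0 := rfl
  rw [h, ← Measure.map_map (by fun_prop) (by fun_prop), pathLaw, Kernel.trajMeasure,
    Measure.map_comp _ _ (by fun_prop), Kernel.traj_map_frestrictLe, Kernel.partialTraj_self,
    Measure.id_comp]
  exact MeasurableEquiv.map_map_symm _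

/-- The Markov property with a weight `F` depending on the past up to time `n`; the weight needed
later is the indicator of not having hit `B`. -/
theorem lintegral_pathLaw_succ (M : FinMDP S A) (π : S → PMF A) (init : PMF (S × A)) (n : ℕ)
    {F : ((_ : Finset.Iic n) → S × A) → ℝ≥0∞} (hF : Measurable F) (φ : S × A → ℝ≥0∞) :
    ∫⁻ ω, F (Preorder.frestrictLe n ω) * φ (ω (n + 1)) ∂(M.pathLaw π init) =
      ∫⁻ ω, F (Preorder.frestrictLe n ω) * M.enext π φ (ω n) ∂(M.pathLaw π init) := by
  have hφ : ∀ φ : S × A → ℝ≥0∞, Measurable φ := fun φ => measurable_of_finite φ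
  have key := Kernel.map_frestrictLe_trajMeasure_compProd_eq_map_trajMeasure
    (X := fun _ => S × A) (μ₀ := init.toMeasure) (κ := M.stepKernel π) (a := n)
  have hm : Measurable fun x : ((_ : Finset.Iic n) → S × A) × (S × A) => F x.1 * φ x.2 :=
    (hF.comp measurable_fst).mul ((hφ φ).comp measurable_snd)
  have h1 := lintegral_map (μ := M.pathLaw π init) hm
    (g := fun ω => (Preorder.frestrictLe n ω, ω (n + 1))) (by fun_prop)
  rw [← h1]
  unfold pathLaw at *
  rw [← key, Measure.lintegral_compProd hm,
    lintegral_map (Measurable.lintegral_kernel_prod_right' hm) (by fun_prop)]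
  refine lintegral_congr fun ω => ?_
  dsimp only
  rw [lintegral_const_mul _ (hφ φ), lintegral_stepKernel]
  rfl

theorem integrable_pathLaw (M : FinMDP S A) (π : S → PMF A) (init : PMF (S × A)) (n : ℕ)
    (φ : S × A → ℝ) : Integrable (fun ω => φ (ω n)) (M.pathLaw π init) := by
  have hn : Measurable fun ω : ℕ → S × A => ω n := measurable_pi_apply n
  have : IsProbabilityMeasure ((M.pathLaw π init).map fun ω => ω n) :=
    Measure.isProbabilityMeasure_map hn.aemeasurable
  have h : Integrable φ ((M.pathLaw π init).map fun ω => ω n) := .of_finite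
  exact h.comp_measurable hn

theorem integral_pathLaw_zero (M : FinMDP S A) (π : S → PMF A) (init : PMF (S × A))
    (φ : S × A → ℝ) :
    ∫ ω, φ (ω 0) ∂(M.pathLaw π init) = ∑ z, (init z).toReal * φ z := by
  rw [← integral_map (φ := fun ω : ℕ → S × A => ω 0)
    (measurable_pi_apply (X := fun _ : ℕ => S × A) 0).aemeasurable
    (measurable_of_finite φ).aestronglyMeasurable, map_pathLaw_zero, PMF.integral_eq_sum]
  rfl

theorem integral_pathLaw_succ (M : FinMDP S A) (π : S → PMF A) (init : PMF (S × A)) (n : ℕ)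
    (φ : S × A → ℝ) :
    ∫ ω, φ (ω (n + 1)) ∂(M.pathLaw π init) = ∫ ω, M.next π φ (ω n) ∂(M.pathLaw π init) := by
  have key := Kernel.map_frestrictLe_trajMeasure_compProd_eq_map_trajMeasure
    (X := fun _ => S × A) (μ₀ := init.toMeasure) (κ := M.stepKernel π) (a := n)
  have hm : Measurable fun x : ((_ : Finset.Iic n) → S × A) × (S × A) => φ x.2 :=
    (measurable_of_finite φ).comp measurable_snd
  have h1 := integral_map (μ := M.pathLaw π init)
    (φ := fun ω => (Preorder.frestrictLe n ω, ω (n + 1)))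
    (f := fun x : ((_ : Finset.Iic n) → S × A) × (S × A) => φ x.2) (by fun_prop)
    hm.aestronglyMeasurable
  rw [← h1]
  unfold pathLaw at *
  rw [← key, Measure.integral_compProd Integrable.of_finite]
  simp only [integral_stepKernel]
  rw [integral_map (by fun_prop) (measurable_of_finite _).aestronglyMeasurable]
  rfl

/-- One step of the state-action chain killed on `B`. -/
noncomputable def killed (M : FinMDP S A) (π : S → PMF A) (B : Set S) (φ : S × A → ℝ≥0∞)
    (z : S × A) : ℝ≥0∞ :=
  outside B z * M.enext π φ z

/-- Induction on `n`: the Markov property moves the last step into `φ`, and the factor `outside B`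
at time `n` turns `enext` into `killed`. -/
theorem lintegral_killed (M : FinMDP S A) (π : S → PMF A) (init : PMF (S × A)) (B : Set S)
    (n : ℕ) (φ : S × A → ℝ≥0∞) :
    ∫⁻ ω, (∏ i ∈ Finset.range n, outside B (ω i)) * φ (ω n) ∂(M.pathLaw π init) =
      ∑ z, init z * (M.killed π B)^[n] φ z := by
  induction n generalizing φ with
  | zero =>
    simp only [Finset.range_zero, Finset.prod_empty, one_mul, Function.iterate_zero, id]
    rw [← lintegral_map (g := fun ω : ℕ → S × A => ω 0) (measurable_of_finite φ) (by fun_prop),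
      map_pathLaw_zero, lintegral_toMeasure]
  | succ n ih =>
    have h := M.lintegral_pathLaw_succ π init n
      (F := fun x => ∏ i : Finset.Iic n, outside B (x i))
      (Finset.measurable_prod _ fun i _ =>
        (measurable_of_finite (outside B)).comp (measurable_pi_apply i)) φ
    have hp : ∀ ω : ℕ → S × A, ∏ i : Finset.Iic n, outside B (Preorder.frestrictLe n ω i) =
        ∏ i ∈ Finset.range (n + 1), outside B (ω i) := by
      intro ω
      rw [Nat.range_succ_eq_Iic]
      exact Finset.prod_coe_sort (Finset.Iic n) fun i => outside B (ω i)
    simp only [hp] at h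
    rw [h, Function.iterate_succ_apply, ← ih]
    simp only [Finset.prod_range_succ, mul_assoc, killed]

/-- The expected hitting time of `B` from a state-action pair. -/
noncomputable def hitFrom (M : FinMDP S A) (π : S → PMF A) (B : Set S) (z : S × A) : ℝ≥0∞ :=
  ∑' n, (M.killed π B)^[n] (outside B) z

theorem lintegral_hitTime (M : FinMDP S A) (π : S → PMF A) (init : PMF (S × A)) (B : Set S) :
    ∫⁻ ω, hitTime B ω ∂(M.pathLaw π init) = ∑ z, init z * M.hitFrom π B z := by
  simp only [hitTime_eq_tsum]
  have hm : ∀ n, Measurable fun ω : ℕ → S × A => outside B (ω n) := fun n =>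
    (measurable_of_finite (outside B)).comp (measurable_pi_apply n)
  have hm' : ∀ n, Measurable fun ω : ℕ → S × A =>
      (∏ i ∈ Finset.range n, outside B (ω i)) * outside B (ω n) := fun n =>
    (Finset.measurable_prod _ fun i _ => hm i).mul (hm n)
  rw [lintegral_tsum fun n => (hm' n).aemeasurable]
  simp only [lintegral_killed, hitFrom, ← ENNReal.tsum_mul_left]
  exact Summable.tsum_finsetSum fun _ _ => ENNReal.summable

theorem expHit_eq (M : FinMDP S A) (π : S → PMF A) (s : S) (B : Set S) :
    M.expHit π s B = ∑ a, π s a * M.hitFrom π B (s, a) := by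
  classical
  rw [expHit, lawFrom, lintegral_hitTime, Fintype.sum_prod_type, Finset.sum_eq_single s]
  · simp [withAction_apply]
  · intro s' _ hs'
    simp [withAction_apply, hs']
  · simp

/-- The term `n = 0` of the series gives the 1, and each later term is one killed step applied to
its predecessor. -/
theorem hitFrom_eq (M : FinMDP S A) (π : S → PMF A) (B : Set S) (z : S × A) :
    M.hitFrom π B z = outside B z * (1 + ∑ s', M.P z.1 z.2 s' * M.expHit π s' B) := by
  have h : ∀ n, (M.killed π B)^[n + 1] (outside B) z =
      outside B z * ∑ s', M.P z.1 z.2 s' *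
        ∑ a, π s' a * (M.killed π B)^[n] (outside B) (s', a) := fun n => by
    rw [Function.iterate_succ_apply', killed, enext]
  rw [hitFrom, tsum_eq_zero_add' ENNReal.summable]
  simp only [h, expHit_eq, hitFrom, ENNReal.tsum_mul_left, mul_add, mul_one,
    Function.iterate_zero, id]
  rw [Summable.tsum_finsetSum fun _ _ => ENNReal.summable]
  simp only [ENNReal.tsum_mul_left]
  congr 3 with s'
  rw [Summable.tsum_finsetSum fun _ _ => ENNReal.summable]
  simp only [ENNReal.tsum_mul_left]

/-- The first-step equation for expected hitting times. -/
theorem expHit_first_step (M : FinMDP S A) (π : S → PMF A) (B : Set S) {s : S} (hs : s ∉ B) :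
    M.expHit π s B = 1 + ∑ s', ENNReal.ofReal (M.trans π s s') * M.expHit π s' B := by
  rw [expHit_eq]
  simp only [hitFrom_eq, outside, hs, if_false, one_mul, mul_add, mul_one, Finset.sum_add_distrib]
  congr 1
  · exact sum_eq_one (π s)
  · simp only [ofReal_trans, Finset.mul_sum, Finset.sum_mul]
    rw [Finset.sum_comm]
    exact Finset.sum_congr rfl fun _ _ => Finset.sum_congr rfl fun _ _ => by ring

end FinMDP

namespace FinMDP

variable {S A : Type*}

/-! ### Recurrent states -/

section Recurrence

variable [Fintype A] {M : FinMDP S A} {π : S → PMF A}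

theorem exists_accessible_isRecurrent [Finite S] (s : S) :
    ∃ y, M.Accessible π s y ∧ M.IsRecurrent π y := by
  have hne : {x | M.Accessible π s x}.Nonempty := ⟨s, .refl⟩
  -- A state with the fewest accessible states is recurrent: any state accessible from it has the
  -- same accessible set, by minimality.
  obtain ⟨y, hy, hmin⟩ := Set.exists_min_image {x | M.Accessible π s x}
    (fun x => {x' | M.Accessible π x x'}.ncard) (Set.toFinite _) hne
  refine ⟨y, hy, fun x hx => ?_⟩
  have hsub : {x' | M.Accessible π x x'} ⊆ {x' | M.Accessible π y x'} := fun x' h =>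
    Relation.ReflTransGen.trans hx h
  have heq := Set.eq_of_subset_of_ncard_le hsub (hmin x (Relation.ReflTransGen.trans hy hx))
    (Set.toFinite _)
  have hyx : y ∈ {x' | M.Accessible π x x'} := heq ▸ (Relation.ReflTransGen.refl : M.Accessible π y y)
  exact hyx

/-- For a unichain policy every recurrent state is accessible from every state. -/
theorem IsUnichain.accessible [Finite S] (hM : M.IsUnichain π) (s : S) {y : S}
    (hy : y ∈ M.recurrentStates π) : M.Accessible π s y := by
  obtain ⟨x, hsx, hx⟩ := M.exists_accessible_isRecurrent (π := π) s
  have h := hM.unique ⟨x, hx, rfl⟩ ⟨y, hy, rfl⟩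
  have hmem : y ∈ {s' | M.Accessible π x s' ∧ M.Accessible π s' x} := by
    rw [h]
    exact ⟨.refl, .refl⟩
  exact Relation.ReflTransGen.trans hsx hmem.1

theorem mem_recurrentStates_of_trans_pos {s s' : S} (hs : s ∈ M.recurrentStates π)
    (h : 0 < M.trans π s s') : s' ∈ M.recurrentStates π := fun _ hx =>
  (hs _ (Relation.ReflTransGen.head h hx)).tail h

end Recurrence

/-! ### Averages along the trajectory -/

theorem tendsto_average_of_telescoping {a b : ℕ → ℝ} {c C : ℝ}
    (hab : ∀ t, a t = c + b t - b (t + 1)) (hb : ∀ t, |b t| ≤ C) (k : ℕ) :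
    Tendsto (fun N : ℕ => 1 / (N : ℝ) * ∑ t ∈ Finset.range N, a (t + k)) atTop (𝓝 c) := by
  have hsum : ∀ N : ℕ, ∑ t ∈ Finset.range N, a (t + k) = N * c + (b k - b (N + k)) := by
    intro N
    induction N with
    | zero => simp
    | succ N ih =>
      rw [Finset.sum_range_succ, ih, hab, show N + k + 1 = N + 1 + k by ring]
      push_cast
      ring
  have hlim : Tendsto (fun N : ℕ => c + 1 / (N : ℝ) * (b k - b (N + k))) atTop (𝓝 (c + 0)) := by
    refine tendsto_const_nhds.add ?_
    simp only [mul_comm (1 / _ : ℝ)]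
    exact bdd_le_mul_tendsto_zero' (C + C) (.of_forall fun N =>
      (abs_sub _ _).trans (add_le_add (hb _) (hb _))) tendsto_one_div_atTop_nhds_zero_nat
  rw [add_zero] at hlim
  refine hlim.congr' ?_
  filter_upwards [eventually_ne_atTop 0] with N hN
  have : (N : ℝ) ≠ 0 := Nat.cast_ne_zero.2 hN
  rw [hsum]
  field_simp

section Averages

variable [Fintype A]

/-- The mean of a function of the state-action pair under the policy. -/
noncomputable def polMean (π : S → PMF A) (φ : S × A → ℝ) (s : S) : ℝ :=
  ∑ a, (π s a).toReal * φ (s, a)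

theorem polMean_fst (π : S → PMF A) (f : S → ℝ) (s : S) : polMean π (fun z => f z.1) s = f s := by
  simp only [polMean, ← Finset.sum_mul, sum_toReal_eq_one, one_mul]

theorem polMean_mem_Icc {π : S → PMF A} {φ : S × A → ℝ} (hφ : ∀ z, φ z ∈ Set.Icc (0 : ℝ) 1) (s : S) :
    polMean π φ s ∈ Set.Icc (0 : ℝ) 1 := by
  refine ⟨Finset.sum_nonneg fun a _ => mul_nonneg ENNReal.toReal_nonneg (hφ _).1, ?_⟩
  rw [← sum_toReal_eq_one (π s)]
  exact Finset.sum_le_sum fun a _ => mul_le_of_le_one_right ENNReal.toReal_nonneg (hφ _).2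

variable [Fintype S]

/-- The conditional mean of a function of the next state. -/
noncomputable def nextState (M : FinMDP S A) (v : S → ℝ) (z : S × A) : ℝ :=
  ∑ s', (M.P z.1 z.2 s').toReal * v s'

variable (M : FinMDP S A) (π : S → PMF A)

theorem polMean_nextState (v : S → ℝ) (s : S) :
    polMean π (M.nextState v) s = ∑ s', M.trans π s s' * v s' := by
  simp only [polMean, nextState, trans, Finset.mul_sum, Finset.sum_mul]
  rw [Finset.sum_comm]
  exact Finset.sum_congr rfl fun _ _ => Finset.sum_congr rfl fun _ _ => by ring

theorem next_eq (φ : S × A → ℝ) : M.next π φ = M.nextState (polMean π φ) := rfl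

variable {π}

/-- This lifts a Poisson equation from states to state-action pairs: with `w = φ - c + M.nextState
v`, the action mean of `w` is `v`, hence `φ = c + w - M.next π w`. -/
theorem polMean_lift {φ : S × A → ℝ} {c : ℝ} {v : S → ℝ}
    (h : ∀ s, polMean π φ s = c + v s - ∑ s', M.trans π s s' * v s') :
    polMean π (fun z => φ z - c + M.nextState v z) = v := by
  ext s
  have h1 : polMean π (fun z => φ z - c + M.nextState v z) s =
      polMean π φ s - polMean π (fun _ => c) s + polMean π (M.nextState v) s := by
    simp only [polMean, mul_add, mul_sub, Finset.sum_add_distrib, Finset.sum_sub_distrib]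
  rw [h1, polMean_nextState, h, polMean_fst π (fun _ => c)]
  ring

theorem IsUnichain.exists_poisson {M : FinMDP S A} (hM : M.IsUnichain π) {b : S} (hb : b ∈ M.recurrentStates π)
    (f : S → ℝ) : ∃ (c : ℝ) (v : S → ℝ), ∀ s, f s = c + v s - ∑ s', M.trans π s s' * v s' :=
  StochMatrix.exists_poisson_solution (M.trans_nonneg π) (M.sum_trans π)
    (fun s => hM.accessible s hb) f

variable [MeasurableSpace S] [MeasurableSingletonClass S]
  [MeasurableSpace A] [MeasurableSingletonClass A]

theorem abs_integral_pathLaw_le (init : PMF (S × A)) (φ : S × A → ℝ) :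
    ∃ C, ∀ t, |∫ ω, φ (ω t) ∂(M.pathLaw π init)| ≤ C := by
  refine ⟨∑ z, |φ z|, fun t => ?_⟩
  have h := norm_integral_le_of_norm_le_const (μ := M.pathLaw π init) (f := fun ω => φ (ω t))
    (C := ∑ z, |φ z|) (.of_forall fun ω =>
      Finset.single_le_sum (f := fun z => |φ z|) (fun _ _ => abs_nonneg _) (Finset.mem_univ (ω t)))
  simpa using h

/-- Along every trajectory law the averages of `φ(s_t, a_t)` converge in mean to the constant of
a Poisson equation with right-hand side `φ`. -/
theorem tendsto_average_integral {φ : S × A → ℝ} {c : ℝ} {v : S → ℝ}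
    (h : ∀ s, polMean π φ s = c + v s - ∑ s', M.trans π s s' * v s')
    (init : PMF (S × A)) (k : ℕ) :
    Tendsto (fun N : ℕ => 1 / (N : ℝ) *
      ∑ t ∈ Finset.range N, ∫ ω, φ (ω (t + k)) ∂(M.pathLaw π init)) atTop (𝓝 c) := by
  let w : S × A → ℝ := fun z => φ z - c + M.nextState v z
  obtain ⟨C, hC⟩ := M.abs_integral_pathLaw_le (π := π) init w
  refine tendsto_average_of_telescoping (a := fun t => ∫ ω, φ (ω t) ∂(M.pathLaw π init))
    (b := fun t => ∫ ω, w (ω t) ∂(M.pathLaw π init)) (fun t => ?_) hC k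
  have hφ : ∀ z, φ z = c + w z - M.next π w z := fun z => by
    rw [next_eq, M.polMean_lift h]; simp only [w]; ring
  have hi := fun ψ => M.integrable_pathLaw π init t ψ
  simp only [integral_pathLaw_succ]
  calc ∫ ω, φ (ω t) ∂(M.pathLaw π init)
      = ∫ ω, (c + w (ω t) - M.next π w (ω t)) ∂(M.pathLaw π init) :=
        integral_congr_ae (.of_forall fun ω => hφ (ω t))
    _ = _ := by
        rw [integral_sub (hi fun z => c + w z) (hi _),
          integral_add (integrable_const c) (hi w)]
        simp


/-! ### The stationary distribution -/

theorem real_setOf_fst_eq (init : PMF (S × A)) (s : S) (t : ℕ) [DecidableEq S] :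
    (M.pathLaw π init).real {ω | (ω t).1 = s} =
      ∫ ω, (if (ω t).1 = s then 1 else 0 : ℝ) ∂(M.pathLaw π init) := by
  have hm : MeasurableSet {ω : ℕ → S × A | (ω t).1 = s} :=
    (measurable_fst.comp (measurable_pi_apply t)) (measurableSet_singleton s)
  rw [← integral_indicator_one hm]
  simp only [Set.indicator_apply, Set.mem_ofPred_eq, Pi.one_apply]

variable {M}

theorem IsUnichain.tendsto_occupation (hM : M.IsUnichain π) {b : S}
    (hb : b ∈ M.recurrentStates π) (s : S) :
    Tendsto (M.occupation π s) atTop (𝓝 (M.d π s)) := by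
  classical
  obtain ⟨c, v, h⟩ := hM.exists_poisson hb (fun s' => if s' = s then 1 else 0)
  have h1 := M.tendsto_average_integral (φ := fun z => if z.1 = s then 1 else 0) (c := c) (v := v)
    (fun s' => by rw [← h, polMean_fst π (fun s' => if s' = s then 1 else 0)])
    (withAction π M.ρ) 0
  refine tendsto_nhds_limUnder ⟨c, h1.congr fun N => ?_⟩
  simp only [occupation, lawρ, real_setOf_fst_eq, add_zero]

theorem IsUnichain.d_nonneg (hM : M.IsUnichain π) {b : S}
    (hb : b ∈ M.recurrentStates π) (s : S) : 0 ≤ M.d π s :=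
  ge_of_tendsto' (hM.tendsto_occupation hb s) fun N =>
    mul_nonneg (by positivity) (Finset.sum_nonneg fun _ _ => measureReal_nonneg)

/-- The mean under `d^π` of the right-hand side of a Poisson equation is its constant. -/
theorem IsUnichain.sum_d_mul (hM : M.IsUnichain π) {b : S} (hb : b ∈ M.recurrentStates π)
    (f : S → ℝ) (c : ℝ) (v : S → ℝ) (h : ∀ s, f s = c + v s - ∑ s', M.trans π s s' * v s') :
    ∑ s, M.d π s * f s = c := by
  classical
  have h1 := M.tendsto_average_integral (φ := fun z => f z.1) (c := c) (v := v)
    (fun s => by rw [← h, polMean_fst π f]) (withAction π M.ρ) 0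
  have h2 : Tendsto (fun N => ∑ s, M.occupation π s N * f s) atTop
      (𝓝 (∑ s, M.d π s * f s)) :=
    tendsto_finsetSum _ fun s _ => (hM.tendsto_occupation hb s).mul_const _
  -- The averages of `f(s_t)` are also the means of `f` under the occupation measures, so the two
  -- limits agree.
  refine tendsto_nhds_unique (h2.congr fun N => ?_) h1
  simp only [occupation, lawρ, mul_assoc, ← Finset.mul_sum, Finset.sum_mul, add_zero]
  rw [Finset.sum_comm]
  congr 1
  refine Finset.sum_congr rfl fun t _ => ?_
  simp only [real_setOf_fst_eq, ← integral_mul_const]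
  rw [← integral_finsetSum _ fun s _ => M.integrable_pathLaw π _ t
    fun z => (if z.1 = s then 1 else 0) * f s]
  simp

theorem IsUnichain.sum_d (hM : M.IsUnichain π) {b : S} (hb : b ∈ M.recurrentStates π) :
    ∑ s, M.d π s = 1 := by
  simpa using hM.sum_d_mul hb (fun _ => 1) 1 0 (fun s => by simp)

/-! ### Average reward and value functions -/

theorem meanReward_eq (N : ℕ) : M.meanReward π N = 1 / (N : ℝ) * ∑ t ∈ Finset.range N,
    ∫ ω, M.r (ω t).1 (ω t).2 ∂(M.pathLaw π (withAction π M.ρ)) := by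
  rw [meanReward, lawρ, integral_finsetSum _ fun t _ =>
    M.integrable_pathLaw π _ t fun z => M.r z.1 z.2]

theorem IsUnichain.tendsto_meanReward (hM : M.IsUnichain π) {b : S}
    (hb : b ∈ M.recurrentStates π) :
    Tendsto (M.meanReward π) atTop (𝓝 (M.J π)) := by
  obtain ⟨c, v, h⟩ := hM.exists_poisson hb (polMean π fun z => M.r z.1 z.2)
  exact tendsto_nhds_limUnder ⟨c, (M.tendsto_average_integral h (withAction π M.ρ) 0).congr
    fun N => (meanReward_eq N).symm⟩

theorem IsUnichain.exists_poisson_reward (hM : M.IsUnichain π) {b : S}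
    (hb : b ∈ M.recurrentStates π) :
    ∃ v : S → ℝ, (∀ s, polMean π (fun z => M.r z.1 z.2) s =
      M.J π + v s - ∑ s', M.trans π s s' * v s') ∧ ∑ s, M.d π s * v s = 0 := by
  obtain ⟨c, v, h⟩ := hM.exists_poisson hb (polMean π fun z => M.r z.1 z.2)
  have hc : c = M.J π := tendsto_nhds_unique
    ((M.tendsto_average_integral h (withAction π M.ρ) 0).congr fun N => (meanReward_eq N).symm)
    (hM.tendsto_meanReward hb)
  subst hc
  -- Adding a constant to `v` preserves the Poisson equation, so the mean can be normalized to zero.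
  refine ⟨fun s => v s - ∑ s, M.d π s * v s, fun s => ?_, ?_⟩
  · rw [h]
    simp only [mul_sub, Finset.sum_sub_distrib, ← Finset.sum_mul, M.sum_trans, one_mul]
    ring
  · simp only [mul_sub, Finset.sum_sub_distrib, ← Finset.sum_mul, hM.sum_d hb, one_mul, sub_self]

/-- The centred reward is `q - M.next π q`, so its partial sums have expectation `E[q(s_0, a_0)] -
E[q(s_{T+1}, a_{T+1})]`. The second term has Cesàro limit zero, because its Poisson constant is the
stationary mean of `v`; it need not converge itself if the chain is periodic. -/
theorem IsUnichain.exists_bellman (hM : M.IsUnichain π) {b : S}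
    (hb : b ∈ M.recurrentStates π) :
    ∃ (v : S → ℝ) (q : S → A → ℝ), M.IsNormalizedBellman π v q ∧
      ∀ init : PMF (S × A), Tendsto (M.cesaro π (M.pathLaw π init)) atTop
        (𝓝 (∑ z, (init z).toReal * q z.1 z.2)) := by
  obtain ⟨v, hv, hdv⟩ := hM.exists_poisson_reward hb
  let q : S × A → ℝ := fun z => M.r z.1 z.2 - M.J π + M.nextState v z
  have hq : polMean π q = v := M.polMean_lift hv
  refine ⟨v, fun s a => q (s, a), ⟨fun s a => rfl, fun s => (congrFun hq s).symm, hdv⟩,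
    fun init => ?_⟩
  obtain ⟨c, v', hv'⟩ := hM.exists_poisson hb v
  have hc : c = 0 := by rw [← hM.sum_d_mul hb v c v' hv', hdv]
  subst hc
  -- The shift is 2 because `T` starts at 1 and the remainder sits at time `T + 1`.
  have hlim := M.tendsto_average_integral (φ := q) (by rwa [hq]) init 2
  have hr : ∀ t, ∫ ω, (M.r (ω t).1 (ω t).2 - M.J π) ∂(M.pathLaw π init) =
      ∫ ω, q (ω t) ∂(M.pathLaw π init) - ∫ ω, q (ω (t + 1)) ∂(M.pathLaw π init) := by
    intro t
    rw [integral_pathLaw_succ, ← integral_sub (M.integrable_pathLaw π init t q)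
      (M.integrable_pathLaw π init t _), next_eq, hq]
    simp only [q, add_sub_cancel_right]
  have hsum : ∀ T, ∫ ω, ∑ t ∈ Finset.range (T + 1), (M.r (ω t).1 (ω t).2 - M.J π)
      ∂(M.pathLaw π init) =
      ∑ z, (init z).toReal * q z - ∫ ω, q (ω (T + 1)) ∂(M.pathLaw π init) := by
    intro T
    rw [integral_finsetSum _ fun t _ =>
      M.integrable_pathLaw π init t fun z => M.r z.1 z.2 - M.J π]
    simp only [hr]
    rw [Finset.sum_range_sub', integral_pathLaw_zero]
  have hlim' := hlim.const_sub (∑ z, (init z).toReal * q z)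
  rw [sub_zero] at hlim'
  refine hlim'.congr' ?_
  filter_upwards [eventually_ne_atTop 0] with N hN
  have hN' : (N : ℝ) ≠ 0 := Nat.cast_ne_zero.2 hN
  simp only [cesaro, hsum]
  rw [← Finset.Ico_add_one_right_eq_Icc, Finset.sum_Ico_eq_sum_range, Nat.add_sub_cancel,
    Finset.sum_sub_distrib, Finset.sum_const, Finset.card_range, nsmul_eq_mul, mul_sub,
    ← mul_assoc, one_div_mul_cancel hN', one_mul]
  simp only [add_comm 1, add_assoc, Nat.reduceAdd]

/-- The difference of two state value functions is harmonic, hence constant, and the normalization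
makes the constant zero since `d` has mass 1. -/
theorem IsUnichain.bellman_unique (hM : M.IsUnichain π) {b : S}
    (hb : b ∈ M.recurrentStates π) {v v' : S → ℝ} {q q' : S → A → ℝ}
    (h : M.IsNormalizedBellman π v q) (h' : M.IsNormalizedBellman π v' q') :
    v = v' ∧ q = q' := by
  have hvw : ∀ s, v s - v' s = ∑ s', M.trans π s s' * (v s' - v' s') := by
    intro s
    have hq : ∀ a, q s a - q' s a = M.nextState (fun s' => v s' - v' s') (s, a) := by
      intro a
      rw [h.1, h'.1]
      simp only [nextState, mul_sub, Finset.sum_sub_distrib]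
      ring
    rw [h.2.1, h'.2.1, ← Finset.sum_sub_distrib, ← polMean_nextState]
    simp only [← mul_sub, hq, polMean]
  have hconst := StochMatrix.eq_of_harmonicOn (M.trans_nonneg π) (M.sum_trans π)
    (F := Set.univ) (fun _ _ _ _ => trivial) (fun s _ => hM.accessible s hb)
    (f := fun s => v s - v' s) (fun s _ => hvw s)
  have hzero : v b - v' b = 0 := by
    have h1 : ∑ s, M.d π s * (v s - v' s) = 0 := by
      simp only [mul_sub, Finset.sum_sub_distrib, h.2.2, h'.2.2, sub_zero]
    simp only [fun s => hconst s trivial] at h1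
    rwa [← Finset.sum_mul, hM.sum_d hb, one_mul] at h1
  have hv : v = v' := by
    ext s
    have := hconst s trivial
    linarith
  refine ⟨hv, ?_⟩
  ext s a
  rw [h.1, h'.1, hv]

theorem IsUnichain.tendsto_cesaro (hM : M.IsUnichain π) {b : S}
    (hb : b ∈ M.recurrentStates π) :
    (∀ s, Tendsto (M.cesaro π (M.lawFrom π s)) atTop (𝓝 (M.V π s))) ∧
      (∀ s a, Tendsto (M.cesaro π (M.lawFromAction π s a)) atTop (𝓝 (M.Q π s a))) ∧
      M.IsNormalizedBellman π (M.V π) (M.Q π) := by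
  classical
  obtain ⟨v, q, hvq, hlim⟩ := hM.exists_bellman hb
  have hV : ∀ s, Tendsto (M.cesaro π (M.lawFrom π s)) atTop (𝓝 (v s)) := by
    intro s
    suffices h : ∑ z, (withAction π (PMF.pure s) z).toReal * q z.1 z.2 = v s from
      h ▸ hlim (withAction π (PMF.pure s))
    rw [Fintype.sum_prod_type, Finset.sum_eq_single s, hvq.2.1]
    · simp [withAction_apply]
    · intro s' _ hs'
      simp [withAction_apply, hs']
    · simp
  have hQ : ∀ s a, Tendsto (M.cesaro π (M.lawFromAction π s a)) atTop (𝓝 (q s a)) := by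
    intro s a
    suffices h : ∑ z, ((PMF.pure (s, a) : PMF (S × A)) z).toReal * q z.1 z.2 = q s a from
      h ▸ hlim (PMF.pure (s, a))
    rw [Finset.sum_eq_single (s, a)]
    · simp
    · intro z _ hz
      simp [hz]
    · simp
  obtain rfl : v = M.V π := funext fun s => (hV s).limUnder_eq.symm
  obtain rfl : q = M.Q π := funext fun s => funext fun a => (hQ s a).limUnder_eq.symm
  exact ⟨hV, hQ, hvq⟩

/-! ### Bounds -/

theorem IsUnichain.J_mem_Icc (hM : M.IsUnichain π) {b : S} (hb : b ∈ M.recurrentStates π) :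
    M.J π ∈ Set.Icc (0 : ℝ) 1 := by
  obtain ⟨v, hv, -⟩ := hM.exists_poisson_reward hb
  have hr : ∀ s, polMean π (fun z => M.r z.1 z.2) s ∈ Set.Icc (0 : ℝ) 1 :=
    polMean_mem_Icc fun z => M.r_mem z.1 z.2
  rw [← hM.sum_d_mul hb _ _ v hv]
  refine ⟨Finset.sum_nonneg fun s _ => mul_nonneg (hM.d_nonneg hb s) (hr s).1, ?_⟩
  rw [← hM.sum_d hb]
  exact Finset.sum_le_sum fun s _ => mul_le_of_le_one_right (hM.d_nonneg hb s) (hr s).2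

/-- The value function is bounded by the sum of the two hitting time constants. -/
theorem IsUnichain.ofReal_abs_V_le (hM : M.IsUnichain π) {b : S}
    (hb : b ∈ M.recurrentStates π) (s : S) :
    ENNReal.ofReal |M.V π s| ≤ M.CHitOf π + M.CTarOf π b := by
  obtain ⟨-, -, hBell⟩ := hM.tendsto_cesaro hb
  have hJ := hM.J_mem_Icc hb
  refine StochMatrix.ofReal_abs_le (M.trans_nonneg π) (M.sum_trans π)
    (fun _ hs _ h => mem_recurrentStates_of_trans_pos hs h) (fun s y hy => hM.accessible s hy)
    (hM.d_nonneg hb) (hM.sum_d_mul hb) hb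
    (e := fun s => polMean π (fun z => M.r z.1 z.2) s - M.J π) (fun s => ?_) (fun s => ?_)
    hBell.2.2 (u := fun s B => M.expHit π s B)
    (fun B s hs => (M.expHit_first_step π B hs).ge) s
  · have hr := polMean_mem_Icc (π := π) (fun z : S × A => M.r_mem z.1 z.2) s
    exact abs_sub_le_of_nonneg_of_le hr.1 hr.2 hJ.1 hJ.2
  · rw [hBell.2.1, ← polMean_nextState, ← polMean_fst π (fun _ => M.J π) s]
    simp only [polMean, ← Finset.sum_sub_distrib, ← Finset.sum_add_distrib, ← mul_sub, ← mul_add,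
      hBell.1, nextState]

end Averages

end FinMDP

/-! ### The bounds in the extended reals -/

theorem EReal.coe_le_coe_ennreal_of_ofReal_le {x : ℝ} {D : ℝ≥0∞} (h : ENNReal.ofReal x ≤ D) :
    (x : EReal) ≤ (D : EReal) := by
  refine le_trans ?_ (EReal.coe_ennreal_le_coe_ennreal_iff.2 h)
  rw [EReal.coe_ennreal_ofReal]
  exact EReal.coe_le_coe_iff.2 (le_max_left _ _)

theorem mainTheorem8 {S A Θ : Type*} [Fintype S] [Fintype A]
    [MeasurableSpace S] [MeasurableSingletonClass S]
    [MeasurableSpace A] [MeasurableSingletonClass A]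
    (M : FinMDP S A) (π : Θ → S → PMF A)
    (hM : ∀ θ, M.IsUnichain (π θ))
    (base : Θ → S) (hbase : ∀ θ, base θ ∈ M.recurrentStates (π θ)) :
    ∀ θ : Θ,
      -- the limits defining the objects exist
      ((∀ s, Tendsto (M.occupation (π θ) s) atTop (𝓝 (M.d (π θ) s))) ∧
        Tendsto (M.meanReward (π θ)) atTop (𝓝 (M.J (π θ))) ∧
        (∀ s, Tendsto (M.cesaro (π θ) (M.lawFrom (π θ) s)) atTop (𝓝 (M.V (π θ) s))) ∧
        (∀ s a, Tendsto (M.cesaro (π θ) (M.lawFromAction (π θ) s a)) atTop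
          (𝓝 (M.Q (π θ) s a)))) ∧
      -- `(V, Q)` is the unique solution of the Bellman equation with stationary mean zero
      (M.IsNormalizedBellman (π θ) (M.V (π θ)) (M.Q (π θ)) ∧
        ∀ v q, M.IsNormalizedBellman (π θ) v q → v = M.V (π θ) ∧ q = M.Q (π θ)) ∧
      -- the bounds, in the extended reals
      ∀ s a,
        (M.V (π θ) s : EReal) ≤ ((2 * (M.CHit π + M.CTar π base) : ℝ≥0∞) : EReal) ∧
        (M.Q (π θ) s a : EReal) ≤ ((1 + 2 * (M.CHit π + M.CTar π base) : ℝ≥0∞) : EReal) ∧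
        (M.adv (π θ) s a : EReal) ≤
          ((1 + 4 * (M.CHit π + M.CTar π base) : ℝ≥0∞) : EReal) := by
  intro θ
  have hM := hM θ
  have hb := hbase θ
  obtain ⟨hV, hQ, hBell⟩ := hM.tendsto_cesaro hb
  refine ⟨⟨hM.tendsto_occupation hb, hM.tendsto_meanReward hb, hV, hQ⟩,
    ⟨hBell, fun v q h => hM.bellman_unique hb h hBell⟩, fun s a => ?_⟩
  -- If the constants sum to `⊤` all three bounds are trivial; otherwise the comparison takes place
  -- in `ℝ`.
  by_cases hC : M.CHit π + M.CTar π base = ⊤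
  · simp [hC, ENNReal.mul_top]
  have hVC : ∀ s, |M.V (π θ) s| ≤ (M.CHit π + M.CTar π base).toReal := fun s => by
    rw [← ENNReal.ofReal_le_iff_le_toReal hC]
    exact (hM.ofReal_abs_V_le hb s).trans (add_le_add
      (le_iSup (fun θ => M.CHitOf (π θ)) θ) (le_iSup (fun θ => M.CTarOf (π θ) (base θ)) θ))
  have hQC : M.Q (π θ) s a ≤ 1 + (M.CHit π + M.CTar π base).toReal := by
    rw [hBell.1]
    -- The 1 bounds `r - J`, since `r ≤ 1` and `J ≥ 0`.
    refine add_le_add (by linarith [(M.r_mem s a).2, (hM.J_mem_Icc hb).1]) ?_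
    calc ∑ s', (M.P s a s').toReal * M.V (π θ) s'
        ≤ ∑ s', (M.P s a s').toReal * (M.CHit π + M.CTar π base).toReal :=
          Finset.sum_le_sum fun s' _ => mul_le_mul_of_nonneg_left
            ((le_abs_self _).trans (hVC s')) ENNReal.toReal_nonneg
      _ = _ := by rw [← Finset.sum_mul, FinMDP.sum_toReal_eq_one, one_mul]
  have hVs := abs_le.1 (hVC s)
  have hnn : 0 ≤ (M.CHit π + M.CTar π base).toReal := ENNReal.toReal_nonneg
  generalize M.CHit π + M.CTar π base = C at *
  have h2 : ∀ k : ℝ≥0∞, k ≠ ⊤ → k * C ≠ ⊤ := fun k hk => ENNReal.mul_ne_top hk hC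
  refine ⟨?_, ?_, ?_⟩ <;> refine EReal.coe_le_coe_ennreal_of_ofReal_le ?_
  · rw [ENNReal.ofReal_le_iff_le_toReal (h2 2 (by simp)), ENNReal.toReal_mul]
    simp only [ENNReal.toReal_ofNat]
    linarith
  · rw [ENNReal.ofReal_le_iff_le_toReal (ENNReal.add_ne_top.2 ⟨by simp, h2 2 (by simp)⟩),
      ENNReal.toReal_add (by simp) (h2 2 (by simp)), ENNReal.toReal_mul]
    simp only [ENNReal.toReal_ofNat, ENNReal.toReal_one]
    linarith
  · rw [ENNReal.ofReal_le_iff_le_toReal (ENNReal.add_ne_top.2 ⟨by simp, h2 4 (by simp)⟩),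
      ENNReal.toReal_add (by simp) (h2 4 (by simp)), ENNReal.toReal_mul]
    simp only [ENNReal.toReal_ofNat, ENNReal.toReal_one, FinMDP.adv]
    linarith
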